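/- A Stirling permutation of order $n$ is an arrangement $\sigma=\sigma_1\sigma_2\cdots\sigma_{2n}$ of the multiset $\{1,1,2,2,\ldots,n,n\}$ such that, for each $1\le i\le n$, all entries between the two occurrences of $i$ are larger than $i$; let $\mathcal{Q}_n$ be the set of these. Put $\sigma_0=0$ and $$\mathrm{ap}(\sigma)=\#\{i\in\{2,\ldots,2n-1\}:\sigma_{i-1}<\sigma_i=\sigma_{i+1}\},\qquad \mathrm{lap}(\sigma)=\#\{i\in\{1,\ldots,2n-1\}:\sigma_{i-1}<\sigma_i=\sigma_{i+1}\}.$$ The ascent-plateau polynomial and the left ascent-plateau polynomial are $$M_n(x)=\sum_{\sigma\in\mathcal{Q}_n}x^{\mathrm{ap}(\sigma)},\qquad N_n(x)=\sum_{\sigma\in\mathcal{Q}_n}x^{\mathrm{lap}(\sigma)}.$$ A polynomial $f(x)=\sum_{i=0}^{d}f_ix^i$ of degree $d$ is alternatingly increasing if $f_0\le f_d\le f_1\le f_{d-1}\le\cdots\le f_{\lfloor (d+1)/2\rfloor}$, and it is unimodal with mode $k$ (where $0\le k\le d$) if $f_0\le\cdots\le f_k\ge f_{k+1}\ge\cdots\ge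 f_d$. Theorem. For every $n\ge 1$, $M_n(x)$ has degree $n-1$, $N_n(x)$ has degree $n$, and both polynomials are alternatingly increasing. Hence both are unimodal with modes in the middle: $\lfloor n/2\rfloor$ is a mode of $M_n(x)$ and $\lfloor (n+1)/2\rfloor$ is a mode of $N_n(x)$. -/

import Mathlib

open Polynomial

namespace StirlingPerm

/-- The `i`-th letter `σ(i)` of the word `σ = σ(1)σ(2)⋯`, indexed from `1`, with the convention
`σ(0) = 0`. -/
def letter (σ : List ℕ) (i : ℕ) : ℕ := (0 :: σ).getD i 0

/-- Between two occurrences of a letter all entries are larger than that letter. -/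
def IsStirlingWord (σ : List ℕ) : Prop :=
  ∀ k ∈ Finset.Icc 1 σ.length, ∀ j ∈ Finset.Ico 1 k, ∀ i ∈ Finset.Ico 1 j,
    letter σ i = letter σ k → letter σ i < letter σ j

instance : DecidablePred IsStirlingWord := fun σ => by
  unfold IsStirlingWord; infer_instance

/-- The set `𝒬ₙ` of Stirling permutations of order `n`: the arrangements of the multiset
`{1,1,2,2,…,n,n}` in which all entries between the two occurrences of `i` are larger than `i`. -/
def stirlingPermutations (n : ℕ) : Finset (List ℕ) :=
  (Multiset.lists (2 • (Finset.Icc 1 n).val)).toFinset.filter IsStirlingWord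

/-- The ascent-plateau number: indices `i ∈ [2, 2n-1]` with `σ(i-1) < σ(i) = σ(i+1)`. -/
def ap (σ : List ℕ) : ℕ :=
  ((Finset.Icc 2 (σ.length - 1)).filter
    fun i => letter σ (i - 1) < letter σ i ∧ letter σ i = letter σ (i + 1)).card

/-- The left ascent-plateau number: indices `i ∈ [1, 2n-1]` with `σ(i-1) < σ(i) = σ(i+1)`,
where `σ(0) = 0`. -/
def lap (σ : List ℕ) : ℕ :=
  ((Finset.Icc 1 (σ.length - 1)).filter
    fun i => letter σ (i - 1) < letter σ i ∧ letter σ i = letter σ (i + 1)).card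

/-- The ascent-plateau polynomial `Mₙ(x)`. -/
noncomputable def M (n : ℕ) : ℤ[X] := ∑ σ ∈ stirlingPermutations n, X ^ ap σ

/-- The left ascent-plateau polynomial `Nₙ(x)`. -/
noncomputable def N (n : ℕ) : ℤ[X] := ∑ σ ∈ stirlingPermutations n, X ^ lap σ

/-- `k` is a mode of `f = f₀ + f₁ x + ⋯ + f_d x^d`, `d = deg f`:
`f₀ ≤ f₁ ≤ ⋯ ≤ f_k ≥ f_{k+1} ≥ ⋯ ≥ f_d`. -/
def IsMode (f : ℤ[X]) (k : ℕ) : Prop :=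
  k ≤ f.natDegree ∧
    (∀ i, i < k → f.coeff i ≤ f.coeff (i + 1)) ∧
    (∀ i, k ≤ i → i < f.natDegree → f.coeff (i + 1) ≤ f.coeff i)

/-- A polynomial is unimodal if it has a mode. -/
def IsUnimodal (f : ℤ[X]) : Prop := ∃ k, IsMode f k

/-- `f₀ ≤ f_d ≤ f₁ ≤ f_{d-1} ≤ ⋯ ≤ f_{⌊(d+1)/2⌋}`, where `d = deg f`. -/
def AlternatinglyIncreasing (f : ℤ[X]) : Prop :=
  (∀ i, 2 * i ≤ f.natDegree → f.coeff i ≤ f.coeff (f.natDegree - i)) ∧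
    (∀ i, 2 * i + 1 ≤ f.natDegree → f.coeff (f.natDegree - i) ≤ f.coeff (i + 1))

end StirlingPerm

/-! Deleting the adjacent pair of largest letters shows that every Stirling permutation of order `n
+ 1` arises exactly once by inserting `(n+1)(n+1)` into one of order `n`. A plateau `a < b = b` has
two slots, `a|b` and `b|b`, where insertion trades it for a new one. The front slot changes nothing
unless a leading `0` is present, and every other slot adds a plateau. This gives `coeff_M_succ` and
`coeff_N_succ`.

The two recurrences are exchanged by `k ↦ n + 1 - k`, so `N_n(x) = x^n M_n(1/x)`. For `M`, each new
difference in the alternating chain is a nonnegative combination of old ones (`coeff_M_chain`). The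
chain for `N` is the one for `M` with a `0` in front. Skipping every other term of a chain gives
unimodality. -/

namespace StirlingPerm

/-! ### Plateau counts under insertion of a large pair -/

/-- The number of places `a, b, b` with `a < b` among three consecutive letters of a word. -/
def ascPlateaus : List ℕ → ℕ
  | a :: b :: c :: l => (if a < b ∧ b = c then 1 else 0) + ascPlateaus (b :: c :: l)
  | _ => 0

/-- The words obtained from a word by inserting two adjacent letters `m`. -/
def insertions (m : ℕ) : List ℕ → List (List ℕ)
  | [] => [[m, m]]
  | b :: v => (m :: m :: b :: v) :: (insertions m v).map (b :: ·)

theorem mem_insertions {m : ℕ} {σ τ : List ℕ} :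
    τ ∈ insertions m σ ↔ ∃ p q, p ++ q = σ ∧ τ = p ++ m :: m :: q := by
  induction σ generalizing τ with
  | nil => simp [insertions]
  | cons b v ih =>
    simp only [insertions, List.mem_cons, List.mem_map, ih]
    constructor
    · rintro (rfl | ⟨_, ⟨p, q, rfl, rfl⟩, rfl⟩)
      · exact ⟨[], _, rfl, rfl⟩
      · exact ⟨b :: p, q, rfl, rfl⟩
    · rintro ⟨_ | ⟨c, p⟩, q, h, rfl⟩
      · left; simp_all
      · right
        simp only [List.cons_append, List.cons.injEq] at h
        exact ⟨_, ⟨p, q, h.2, rfl⟩, by simp [h.1]⟩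

theorem nodup_insertions {m : ℕ} {σ : List ℕ} (h : m ∉ σ) : (insertions m σ).Nodup := by
  induction σ with
  | nil => simp [insertions]
  | cons b v ih =>
    simp only [List.mem_cons, not_or] at h
    simp only [insertions, List.nodup_cons, List.mem_map, not_exists, not_and]
    refine ⟨fun w _ hw => h.1 ?_, (ih h.2).map fun _ _ => by simp⟩
    simp only [List.cons.injEq] at hw
    exact hw.1.symm

theorem ascPlateaus_cons_of_le {a b : ℕ} (h : b ≤ a) (v : List ℕ) :
    ascPlateaus (a :: b :: v) = ascPlateaus (b :: v) := by
  cases v <;> simp [ascPlateaus, h.not_gt]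

/-- No insertion happens before `a`. The slots `a|b` and `b|b` of distinct plateaus are distinct, so
twice the plateau count many slots preserve it. The test function `F` is arbitrary so that the
induction can shift it. -/
theorem sum_insertions_cons (m a : ℕ) (v : List ℕ) (F : ℕ → ℤ) (ha : a < m) (hv : ∀ b ∈ v, b < m) :
    ((insertions m v).map fun w => F (ascPlateaus (a :: w))).sum =
      2 * ascPlateaus (a :: v) * F (ascPlateaus (a :: v)) +
        (v.length + 1 - 2 * ascPlateaus (a :: v)) * F (ascPlateaus (a :: v) + 1) := by
  induction v generalizing a F with
  | nil => simp [insertions, ascPlateaus, ha]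
  | cons b v ih =>
    have hb : b < m := hv b (by simp)
    have hv' : ∀ c ∈ v, c < m := fun c hc => hv c (by simp [hc])
    cases v with
    | nil =>
      simp [insertions, ascPlateaus, ha, hb, hb.ne]
      ring
    | cons c v =>
      have hc : c < m := hv' c (by simp)
      have h := ih b F hb hv'
      -- A plateau at the front that survives adds one to every count further right.
      have h' := ih b (fun e => F (1 + e)) hb hv'
      by_cases hab : a < b ∧ b = c
      · obtain ⟨hab, rfl⟩ := hab
        have e1 := ascPlateaus_cons_of_le hb.le v
        have e2 := ascPlateaus_cons_of_le (le_refl b) v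
        simp [insertions, ascPlateaus, ha, hab, hb, hb.ne, hb.not_gt, Function.comp_def, e1, e2]
          at h h' ⊢
        simp only [add_comm, add_left_comm] at h h' ⊢
        ring_nf at h h' ⊢
        linarith
      · simp [insertions, ascPlateaus, ha, hab, hb, hb.ne, hb.not_gt, hc.ne', Function.comp_def]
          at h h' ⊢
        simp only [add_comm, add_left_comm] at h h' ⊢
        ring_nf at h h' ⊢
        linarith

theorem sum_insertions (m : ℕ) (v : List ℕ) (F : ℕ → ℤ) (hv : ∀ b ∈ v, b < m) (h0 : v ≠ []) :
    ((insertions m v).map fun w => F (ascPlateaus w)).sum =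
      (2 * ascPlateaus v + 1) * F (ascPlateaus v) +
        (v.length - 2 * ascPlateaus v) * F (ascPlateaus v + 1) := by
  obtain ⟨a, v, rfl⟩ := List.exists_cons_of_ne_nil h0
  have ha : a < m := hv a (by simp)
  have h := sum_insertions_cons m a v F ha fun b hb => hv b (by simp [hb])
  have h1 : ascPlateaus (m :: m :: a :: v) = ascPlateaus (a :: v) := by
    rw [ascPlateaus_cons_of_le le_rfl, ascPlateaus_cons_of_le ha.le]
  simp only [insertions, List.map_cons, List.map_map, Function.comp_def, List.sum_cons, h, h1,
    List.length_cons]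
  push_cast
  ring

theorem ascPlateaus_eq_sum (w : List ℕ) :
    ascPlateaus w = ∑ i ∈ Finset.range (w.length - 2),
      if w.getD i 0 < w.getD (i + 1) 0 ∧ w.getD (i + 1) 0 = w.getD (i + 2) 0 then 1 else 0 := by
  induction w with
  | nil => simp [ascPlateaus]
  | cons a w ih =>
    match w with
    | [] => simp [ascPlateaus]
    | [b] => simp [ascPlateaus]
    | b :: c :: l =>
      rw [ascPlateaus, ih]
      have : (a :: b :: c :: l).length - 2 = ((b :: c :: l).length - 2) + 1 := by simp
      rw [this, Finset.sum_range_succ', add_comm]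
      simp

theorem lap_eq_ascPlateaus (σ : List ℕ) : lap σ = ascPlateaus (0 :: σ) := by
  rw [lap, Finset.card_filter, ascPlateaus_eq_sum, ← Finset.Ico_add_one_right_eq_Icc,
    Finset.sum_Ico_eq_sum_range]
  refine Finset.sum_congr (by simp) fun i _ => ?_
  simp only [letter, show 1 + i = i + 1 by omega, Nat.add_sub_cancel]

theorem ap_eq_ascPlateaus (σ : List ℕ) : ap σ = ascPlateaus σ := by
  rw [ap, Finset.card_filter, ascPlateaus_eq_sum, ← Finset.Ico_add_one_right_eq_Icc,
    Finset.sum_Ico_eq_sum_range]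
  refine Finset.sum_congr (by congr 1) fun i _ => ?_
  simp only [letter, show 2 + i = i + 1 + 1 by omega, Nat.add_sub_cancel,
    List.getD_cons_succ]

/-! ### Stirling permutations by insertion -/

/-- In this pattern form the condition passes to sublists, and filtering out a letter transports
patterns. -/
theorem isStirlingWord_iff {σ : List ℕ} :
    IsStirlingWord σ ↔ ∀ a b, [a, b, a].Sublist σ → a < b := by
  have hl : ∀ i (h : i < σ.length), letter σ (i + 1) = σ[i] := fun i h => by simp [letter, h]
  constructor
  · intro h a b hs
    obtain ⟨is, h1, h2⟩ := List.sublist_eq_map_getElem hs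
    obtain ⟨i, j, k, rfl⟩ : ∃ i j k, is = [i, j, k] := by
      have : is.length = 3 := by simpa using (congrArg List.length h1).symm
      exact List.length_eq_three.1 this
    simp only [List.map_cons, List.map_nil, List.cons.injEq, and_true] at h1
    simp only [List.pairwise_cons, List.mem_cons, forall_eq_or_imp] at h2
    have hij : i.1 < j.1 := h2.1.1
    have hjk : j.1 < k.1 := h2.2.1.1
    have := h (k + 1) (by simp) (j + 1) (by simp; omega) (i + 1) (by simp; omega)
    rw [hl _ i.2, hl _ j.2, hl _ k.2] at this
    have e1 : a = σ[i.1] := h1.1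
    have e2 : b = σ[j.1] := h1.2.1
    have e3 : a = σ[k.1] := h1.2.2
    rw [e2, e1]
    exact this (e1.symm.trans e3)
  · intro h k hk j hj i hi
    simp only [Finset.mem_Icc, Finset.mem_Ico] at hk hj hi
    obtain ⟨k, rfl⟩ := Nat.exists_eq_add_of_le' hk.1
    obtain ⟨j, rfl⟩ := Nat.exists_eq_add_of_le' hj.1
    obtain ⟨i, rfl⟩ := Nat.exists_eq_add_of_le' hi.1
    rw [hl i (by omega), hl j (by omega), hl k (by omega)]
    intro e
    apply h
    have := List.map_getElem_sublist (l := σ)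
      (is := [⟨i, by omega⟩, ⟨j, by omega⟩, ⟨k, by omega⟩]) (by simp; omega)
    simpa [← e] using this

theorem mem_stirlingPermutations {n : ℕ} {σ : List ℕ} :
    σ ∈ stirlingPermutations n ↔
      2 • (Finset.Icc 1 n).val = (σ : Multiset ℕ) ∧ ∀ a b, [a, b, a].Sublist σ → a < b := by
  rw [stirlingPermutations, Finset.mem_filter, Multiset.mem_toFinset, Multiset.mem_lists_iff,
    isStirlingWord_iff]
  rfl

theorem mem_le_of_mem {n : ℕ} {σ : List ℕ} (h : σ ∈ stirlingPermutations n) {b : ℕ}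
    (hb : b ∈ σ) : b ≤ n := by
  have : b ∈ 2 • (Finset.Icc 1 n).val := by rw [(mem_stirlingPermutations.1 h).1]; exact hb
  rw [Multiset.mem_nsmul_of_ne_zero (by norm_num), Finset.mem_val, Finset.mem_Icc] at this
  exact this.2

theorem length_of_mem {n : ℕ} {σ : List ℕ} (h : σ ∈ stirlingPermutations n) :
    σ.length = 2 * n := by
  have := congrArg Multiset.card (mem_stirlingPermutations.1 h).1
  simpa using this.symm

theorem two_nsmul_Icc_succ (n : ℕ) : 2 • (Finset.Icc 1 (n + 1)).val =
    (n + 1) ::ₘ (n + 1) ::ₘ 2 • (Finset.Icc 1 n).val := by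
  have : (Finset.Icc 1 (n + 1)).val = (n + 1) ::ₘ (Finset.Icc 1 n).val := by
    rw [← Finset.insert_Icc_right_eq_Icc_add_one (by omega), Finset.insert_val_of_notMem (by simp)]
  rw [this, two_nsmul, two_nsmul]
  simp [Multiset.cons_add, Multiset.add_cons]

theorem insertion_mem {n : ℕ} {p q : List ℕ} (h : p ++ q ∈ stirlingPermutations n) :
    p ++ (n + 1) :: (n + 1) :: q ∈ stirlingPermutations (n + 1) := by
  have hle := fun b => mem_le_of_mem (b := b) h
  obtain ⟨h1, h2⟩ := mem_stirlingPermutations.1 h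
  have hp : n + 1 ∉ p := fun hm => by have := hle _ (List.mem_append_left _ hm); omega
  have hq : n + 1 ∉ q := fun hm => by have := hle _ (List.mem_append_right _ hm); omega
  refine mem_stirlingPermutations.2 ⟨?_, fun a b hs => ?_⟩
  · rw [two_nsmul_Icc_succ, h1, Multiset.cons_coe, Multiset.cons_coe, Multiset.coe_eq_coe]
    exact (List.perm_middle.trans (List.perm_middle.cons _)).symm
  · have hfilter : (p ++ (n + 1) :: (n + 1) :: q).filter (· ≠ n + 1) = p ++ q := by
      simp only [List.filter_append, ne_eq, List.filter_cons]
      simp only [not_true, decide_false, Bool.false_eq_true, if_false]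
      rw [← List.filter_append, List.filter_eq_self]
      intro b hb
      have := hle b hb
      simp; omega
    by_cases ha : a = n + 1
    · exfalso
      subst ha
      -- Since `n + 1` does not occur in `p`, the pattern lies in the suffix, which has too few
      -- copies of `n + 1`.
      have h3 : [n + 1, b, n + 1].Sublist ((n + 1) :: (n + 1) :: q) := by
        clear hfilter h h1 h2 hle
        induction p with
        | nil => exact hs
        | cons c p ih =>
          simp only [List.mem_cons, not_or] at hp
          exact ih hp.2 (hs.of_cons_of_ne hp.1)
      have h4 := List.cons_sublist_cons.1 h3
      by_cases hb : b = n + 1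
      · subst hb
        exact hq ((List.cons_sublist_cons.1 h4).subset (by simp))
      · exact hq ((h4.of_cons_of_ne hb).subset (by simp))
    · have ha' : a ∈ p ++ q := by
        rw [← hfilter]
        exact List.mem_filter.2 ⟨hs.subset (by simp), by simpa using ha⟩
      by_cases hb : b = n + 1
      · have := hle a ha'
        omega
      · apply h2
        rw [← hfilter]
        have := hs.filter (· ≠ n + 1)
        simpa [ha, hb] using this

/-- A letter between the two copies of `n + 1` would have to exceed the maximum, so the copies are
adjacent. -/
theorem exists_insertion {n : ℕ} {τ : List ℕ} (h : τ ∈ stirlingPermutations (n + 1)) :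
    ∃ p q, p ++ q ∈ stirlingPermutations n ∧ τ = p ++ (n + 1) :: (n + 1) :: q := by
  have hle := fun b => mem_le_of_mem (b := b) h
  obtain ⟨h1, h2⟩ := mem_stirlingPermutations.1 h
  rw [two_nsmul_Icc_succ] at h1
  have hm : n + 1 ∈ τ := by rw [← Multiset.mem_coe, ← h1]; simp
  obtain ⟨p, r, rfl, hp⟩ := List.eq_append_cons_of_mem hm
  have h3 : (n + 1) ::ₘ 2 • (Finset.Icc 1 n).val = ((p ++ r : List ℕ) : Multiset ℕ) := by
    rw [← Multiset.cons_inj_right (n + 1), h1, Multiset.cons_coe, Multiset.coe_eq_coe]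
    exact List.perm_middle
  have hr : n + 1 ∈ r := by
    have : n + 1 ∈ p ++ r := by rw [← Multiset.mem_coe, ← h3]; simp
    exact (List.mem_append.1 this).resolve_left hp
  match r with
  | [] => simp at hr
  | b :: q =>
    obtain rfl : b = n + 1 := by
      by_contra hb
      have hq : n + 1 ∈ q := (List.mem_cons.1 hr).resolve_left (Ne.symm hb)
      have hlt := h2 (n + 1) b <| List.Sublist.trans
        (.cons_cons _ (.cons_cons _ (List.singleton_sublist.2 hq))) (List.sublist_append_right p _)
      have := hle b (by simp)
      omega
    refine ⟨p, q, mem_stirlingPermutations.2 ⟨?_, fun a b hs => h2 a b (hs.trans ?_)⟩, rfl⟩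
    · rw [← Multiset.cons_inj_right (n + 1), h3, Multiset.cons_coe, Multiset.coe_eq_coe]
      exact List.perm_middle
    · exact (List.Sublist.refl p).append ((List.sublist_cons_self _ _).trans
        (List.sublist_cons_self _ _))

theorem sum_stirlingPermutations_succ (n : ℕ) (F : List ℕ → ℤ) :
    ∑ τ ∈ stirlingPermutations (n + 1), F τ =
      ∑ σ ∈ stirlingPermutations n, ((insertions (n + 1) σ).map F).sum := by
  have hn : ∀ σ ∈ stirlingPermutations n, n + 1 ∉ σ := fun σ hσ hm => by
    have := mem_le_of_mem hσ hm
    omega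
  have hE : stirlingPermutations (n + 1) =
      (stirlingPermutations n).biUnion fun σ => (insertions (n + 1) σ).toFinset := by
    ext τ
    simp only [Finset.mem_biUnion, List.mem_toFinset, mem_insertions]
    constructor
    · intro h
      obtain ⟨p, q, hpq, rfl⟩ := exists_insertion h
      exact ⟨_, hpq, p, q, rfl, rfl⟩
    · rintro ⟨_, h, p, q, rfl, rfl⟩
      exact insertion_mem h
  -- Erasing `n + 1` recovers `σ`, so the union is disjoint.
  have hfilter : ∀ σ ∈ stirlingPermutations n, ∀ τ ∈ insertions (n + 1) σ,
      τ.filter (· ≠ n + 1) = σ := by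
    intro σ hσ τ hτ
    obtain ⟨p, q, rfl, rfl⟩ := mem_insertions.1 hτ
    have := hn _ hσ
    simp only [List.filter_append, ne_eq, List.filter_cons]
    simp only [not_true, decide_false, Bool.false_eq_true, if_false]
    rw [← List.filter_append, List.filter_eq_self]
    intro b hb
    simp only [decide_not, Bool.not_eq_true', decide_eq_false_iff_not]
    rintro rfl
    exact this hb
  rw [hE, Finset.sum_biUnion]
  · exact Finset.sum_congr rfl fun σ hσ => List.sum_toFinset F (nodup_insertions (hn σ hσ))
  · intro σ hσ σ' hσ' hne
    rw [Function.onFun, Finset.disjoint_left]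
    intro τ hτ hτ'
    rw [List.mem_toFinset] at hτ hτ'
    exact hne ((hfilter σ hσ τ hτ).symm.trans (hfilter σ' hσ' τ hτ'))

/-! ### Recurrences, degrees and reversal -/

theorem coeff_M (n k : ℕ) :
    (M n).coeff k = ∑ σ ∈ stirlingPermutations n, if ascPlateaus σ = k then 1 else 0 := by
  simp [M, coeff_X_pow, ap_eq_ascPlateaus, eq_comm]

theorem coeff_N (n k : ℕ) :
    (N n).coeff k = ∑ σ ∈ stirlingPermutations n, if ascPlateaus (0 :: σ) = k then 1 else 0 := by
  simp [N, coeff_X_pow, lap_eq_ascPlateaus, eq_comm]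

/-- Of the `2n + 1` slots, `2k + 1` preserve `k` plateaus (two each, plus the front), and `2n - 2(k
- 1)` raise `k - 1` to `k`. -/
theorem coeff_M_succ {n : ℕ} (hn : 1 ≤ n) (k : ℕ) :
    (M (n + 1)).coeff k = (2 * k + 1) * (M n).coeff k +
      (2 * n + 2 - 2 * k) * (if k = 0 then 0 else (M n).coeff (k - 1)) := by
  have : (if k = 0 then 0 else (M n).coeff (k - 1)) =
      ∑ σ ∈ stirlingPermutations n, if ascPlateaus σ + 1 = k then 1 else 0 := by
    cases k <;> simp [coeff_M]
  rw [this, coeff_M, coeff_M, sum_stirlingPermutations_succ, Finset.mul_sum, Finset.mul_sum,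
    ← Finset.sum_add_distrib]
  refine Finset.sum_congr rfl fun σ hσ => ?_
  have hl := length_of_mem hσ
  rw [sum_insertions (n + 1) σ (fun e => if e = k then 1 else 0)
    (fun b hb => Nat.lt_succ_of_le (mem_le_of_mem hσ hb)) (by rintro rfl; simp at hl; omega), hl]
  split_ifs <;> subst_vars <;> push_cast <;> omega

/-- With the leading `0` the front slot is no longer neutral, so `2k` slots preserve and `2n + 1 -
2(k - 1)` raise. -/
theorem coeff_N_succ (n k : ℕ) :
    (N (n + 1)).coeff k = 2 * k * (N n).coeff k +
      (2 * n + 3 - 2 * k) * (if k = 0 then 0 else (N n).coeff (k - 1)) := by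
  have : (if k = 0 then 0 else (N n).coeff (k - 1)) =
      ∑ σ ∈ stirlingPermutations n, if ascPlateaus (0 :: σ) + 1 = k then 1 else 0 := by
    cases k <;> simp [coeff_N]
  rw [this, coeff_N, coeff_N, sum_stirlingPermutations_succ, Finset.mul_sum, Finset.mul_sum,
    ← Finset.sum_add_distrib]
  refine Finset.sum_congr rfl fun σ hσ => ?_
  have hl := length_of_mem hσ
  rw [sum_insertions_cons (n + 1) 0 σ (fun e => if e = k then 1 else 0) (by omega)
    (fun b hb => Nat.lt_succ_of_le (mem_le_of_mem hσ hb)), hl]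
  split_ifs <;> subst_vars <;> push_cast <;> omega

theorem stirlingPermutations_one : stirlingPermutations 1 = {[1, 1]} := by
  ext τ
  rw [Finset.mem_singleton]
  have h0 : ∀ σ, σ ∈ stirlingPermutations 0 ↔ σ = [] := fun σ => by
    rw [mem_stirlingPermutations]
    constructor
    · rintro ⟨h, -⟩
      simpa [eq_comm] using h
    · rintro rfl
      simp
  constructor
  · intro h
    obtain ⟨p, q, hpq, rfl⟩ := exists_insertion h
    rw [h0, List.append_eq_nil_iff] at hpq
    simp [hpq.1, hpq.2]
  · rintro rfl
    exact insertion_mem (p := []) (q := []) ((h0 _).2 rfl)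

theorem M_one : M 1 = 1 := by
  simp [M, stirlingPermutations_one, ap_eq_ascPlateaus, ascPlateaus]

theorem N_one : N 1 = X := by
  simp [N, stirlingPermutations_one, lap_eq_ascPlateaus, ascPlateaus]

theorem coeff_M_of_le {n : ℕ} (hn : 1 ≤ n) : ∀ k, n ≤ k → (M n).coeff k = 0 := by
  induction n, hn using Nat.le_induction with
  | base =>
    intro k hk
    rw [M_one, coeff_one, if_neg (by omega)]
  | succ n hn ih =>
    intro k hk
    rw [coeff_M_succ hn, ih k (by omega), ← Nat.succ_pred_eq_of_pos (by omega : 0 < k)]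
    rcases hk.eq_or_lt with rfl | hk
    · simp
      left
      ring
    · simp [ih (k - 1) (by omega)]

theorem coeff_M_zero {n : ℕ} (hn : 1 ≤ n) : (M n).coeff 0 = 1 := by
  induction n, hn using Nat.le_induction with
  | base => simp [M_one]
  | succ n hn ih => simp [coeff_M_succ hn, ih]

theorem coeff_M_last_pos {n : ℕ} (hn : 1 ≤ n) : 0 < (M n).coeff (n - 1) := by
  induction n, hn using Nat.le_induction with
  | base => simp [M_one]
  | succ n hn ih =>
    rw [coeff_M_succ hn, Nat.add_sub_cancel, coeff_M_of_le hn n le_rfl, if_neg (by omega)]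
    linarith

theorem natDegree_M {n : ℕ} (hn : 1 ≤ n) : (M n).natDegree = n - 1 := by
  refine natDegree_eq_of_le_of_coeff_ne_zero ?_ (coeff_M_last_pos hn).ne'
  exact natDegree_le_iff_coeff_eq_zero.2 fun k hk => coeff_M_of_le hn k (by omega)

theorem coeff_N_eq {n : ℕ} (hn : 1 ≤ n) :
    ∀ k, (N n).coeff k = if k ≤ n then (M n).coeff (n - k) else 0 := by
  induction n, hn using Nat.le_induction with
  | base =>
    intro k
    rcases k with _ | _ | k <;> simp [N_one, M_one, coeff_X, coeff_one]
  | succ n hn ih =>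
    intro k
    rw [coeff_N_succ, ih k, ih (k - 1), coeff_M_succ hn]
    rcases Nat.lt_trichotomy k (n + 1) with h | rfl | h
    · rcases k with _ | k
      · have h1 := coeff_M_of_le hn (n + 1) (by omega)
        have h2 := coeff_M_of_le hn n (by omega)
        simp [h1, h2]
      · obtain ⟨j, rfl⟩ : ∃ j, n = k + 1 + j := ⟨n - (k + 1), by omega⟩
        rw [if_pos (by omega), if_neg (by omega), if_pos (by omega), if_pos (by omega),
          if_neg (by omega), show k + 1 + j - (k + 1) = j by omega,
          show k + 1 + j - (k + 1 - 1) = j + 1 by omega,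
          show k + 1 + j + 1 - (k + 1) = j + 1 by omega, Nat.add_sub_cancel]
        push_cast
        ring
    · simp
      ring_nf
    · rw [if_neg (by omega), if_neg (by omega), if_neg (by omega), if_neg (by omega)]
      simp

theorem natDegree_N {n : ℕ} (hn : 1 ≤ n) : (N n).natDegree = n := by
  refine natDegree_eq_of_le_of_coeff_ne_zero ?_ ?_
  · exact natDegree_le_iff_coeff_eq_zero.2 fun k hk => by rw [coeff_N_eq hn, if_neg (by omega)]
  · rw [coeff_N_eq hn, if_pos le_rfl, Nat.sub_self, coeff_M_zero hn]
    norm_num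

theorem coeff_M_nonneg (n k : ℕ) : 0 ≤ (M n).coeff k := by
  rw [coeff_M]
  exact Finset.sum_nonneg fun _ _ => by split_ifs <;> norm_num

/-! ### Alternating inequalities and modes -/

theorem coeff_M_chain {n : ℕ} (hn : 1 ≤ n) :
    (∀ i, 2 * i ≤ n - 1 → (M n).coeff i ≤ (M n).coeff (n - 1 - i)) ∧
      (∀ i, 2 * i + 1 ≤ n - 1 → (M n).coeff (n - 1 - i) ≤ (M n).coeff (i + 1)) := by
  induction n, hn using Nat.le_induction with
  | base =>
    constructor
    · intro i hi
      obtain rfl : i = 0 := by omega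
      simp
    · intro i hi
      omega
  | succ n hn ih =>
    obtain ⟨ha, hb⟩ := ih
    rw [Nat.add_sub_cancel]
    -- the chain of inequalities around index `i`, with the convention that `f₋₁ = 0`
    have low : ∀ i, 2 * i + 1 ≤ n → (M n).coeff (n - i) ≤ (M n).coeff i := by
      intro i hi
      rcases i with _ | i
      · rw [coeff_M_of_le hn (n - 0) (by omega)]
        exact coeff_M_nonneg n 0
      · have := hb i (by omega)
        rwa [show n - 1 - i = n - (i + 1) by omega] at this
    constructor
    · intro i hi
      rcases hi.eq_or_lt with hi | hi
      · rw [show n - i = i by omega]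
      · have h1 := ha i (by omega)
        have h2 := low i (by omega)
        have h3 : (if i = 0 then 0 else (M n).coeff (i - 1)) ≤ (M n).coeff (n - i) := by
          rcases i with _ | i
          · exact coeff_M_nonneg _ _
          · have := ha i (by omega)
            rwa [show n - 1 - i = n - (i + 1) by omega] at this
        rw [coeff_M_succ hn, coeff_M_succ hn, if_neg (by omega : ¬ n - i = 0),
          Nat.sub_right_comm, Nat.cast_sub (by omega)]
        have hin : (2 * i + 1 : ℤ) ≤ n := by omega
        generalize (if i = 0 then 0 else (M n).coeff (i - 1)) = x at *
        -- With `f = M n`, the difference to bound is `p1 + p2 + (f_{n-1-i} - x)`, and `x ≤ f_{n-i}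
        -- ≤ f_i ≤ f_{n-1-i}`.
        have p1 := mul_nonneg (by linarith : (0 : ℤ) ≤ 2 * n - 2 * i + 1) (sub_nonneg.2 h3)
        have p2 := mul_nonneg (by positivity : (0 : ℤ) ≤ 2 * i + 1) (sub_nonneg.2 h1)
        linarith
    · intro i hi
      rcases hi.eq_or_lt with hi | hi
      · rw [show n - i = i + 1 by omega]
      · have h1 := ha i (by omega)
        have h2 := low i (by omega)
        have h3 := hb i (by omega)
        rw [coeff_M_succ hn, coeff_M_succ hn, if_neg (by omega : ¬ n - i = 0),
          if_neg (by omega), Nat.sub_right_comm, Nat.cast_sub (by omega), Nat.add_sub_cancel]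
        have hin : (2 * i + 1 : ℤ) ≤ n := by omega
        -- The difference is now `p1 + p2 + (f_{i+1} - f_{n-i})`, and `f_{n-i} ≤ f_i ≤ f_{n-1-i} ≤
        -- f_{i+1}`.
        have p1 := mul_nonneg (by linarith : (0 : ℤ) ≤ 2 * n - 2 * i) (sub_nonneg.2 h2)
        have p2 := mul_nonneg (by positivity : (0 : ℤ) ≤ 2 * i + 2) (sub_nonneg.2 h3)
        push_cast
        linarith

theorem alternatinglyIncreasing_M {n : ℕ} (hn : 1 ≤ n) : AlternatinglyIncreasing (M n) := by
  rw [AlternatinglyIncreasing, natDegree_M hn]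
  exact coeff_M_chain hn

theorem alternatinglyIncreasing_N {n : ℕ} (hn : 1 ≤ n) : AlternatinglyIncreasing (N n) := by
  obtain ⟨ha, hb⟩ := coeff_M_chain hn
  rw [AlternatinglyIncreasing, natDegree_N hn]
  constructor
  · intro i hi
    rw [coeff_N_eq hn, coeff_N_eq hn, if_pos (by omega), if_pos (by omega),
      show n - (n - i) = i by omega]
    rcases i with _ | i
    · rw [coeff_M_of_le hn (n - 0) (by omega)]
      exact coeff_M_nonneg n 0
    · have := hb i
      rcases hi.eq_or_lt with h | h
      · rw [show n - (i + 1) = i + 1 by omega]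
      · rw [show n - (i + 1) = n - 1 - i by omega]
        exact this (by omega)
  · intro i hi
    rw [coeff_N_eq hn, coeff_N_eq hn, if_pos (by omega), if_pos (by omega),
      show n - (n - i) = i by omega, show n - (i + 1) = n - 1 - i by omega]
    exact ha i (by omega)

/-- Two consecutive links of the chain compare neighbouring coefficients: those on the left ascend,
those on the right descend. -/
theorem AlternatinglyIncreasing.isMode {f : ℤ[X]} (h : AlternatinglyIncreasing f) :
    IsMode f ((f.natDegree + 1) / 2) := by
  obtain ⟨ha, hb⟩ := h
  rcases Nat.eq_zero_or_pos f.natDegree with h0 | h0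
  · simp [IsMode, h0]
  refine ⟨by omega, fun i hi => (ha i (by omega)).trans (hb i (by omega)), fun i hi hid => ?_⟩
  obtain ⟨j, hj⟩ : ∃ j, f.natDegree = i + 1 + j := ⟨f.natDegree - (i + 1), by omega⟩
  have h1 := hb j (by omega)
  have h2 := ha (j + 1) (by omega)
  rw [show f.natDegree - j = i + 1 by omega] at h1
  rw [show f.natDegree - (j + 1) = i by omega] at h2
  exact h1.trans h2

end StirlingPerm

theorem mainTheorem2 (n : ℕ) (hn : 1 ≤ n) :
    ((StirlingPerm.M n).natDegree = n - 1 ∧ (StirlingPerm.N n).natDegree = n) ∧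
    (StirlingPerm.AlternatinglyIncreasing (StirlingPerm.M n) ∧
      StirlingPerm.AlternatinglyIncreasing (StirlingPerm.N n)) ∧
    (StirlingPerm.IsUnimodal (StirlingPerm.M n) ∧ StirlingPerm.IsUnimodal (StirlingPerm.N n)) ∧
    (StirlingPerm.IsMode (StirlingPerm.M n) (n / 2) ∧
      StirlingPerm.IsMode (StirlingPerm.N n) ((n + 1) / 2)) := by

  have hM := (StirlingPerm.alternatinglyIncreasing_M hn).isMode
  have hN := (StirlingPerm.alternatinglyIncreasing_N hn).isMode
  rw [StirlingPerm.natDegree_M hn, Nat.sub_add_cancel hn] at hM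
  rw [StirlingPerm.natDegree_N hn] at hN
  exact ⟨⟨StirlingPerm.natDegree_M hn, StirlingPerm.natDegree_N hn⟩,
    ⟨StirlingPerm.alternatinglyIncreasing_M hn, StirlingPerm.alternatinglyIncreasing_N hn⟩,
    ⟨⟨_, hM⟩, ⟨_, hN⟩⟩, hM, hN⟩
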